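/- All rings are commutative with $1$, and $\dim$ denotes the Krull dimension (possibly $\infty$). Let $R$ be a Noetherian Jacobson ring, i.e. a Noetherian ring in which every prime ideal is an intersection of maximal ideals. Call an $R$-algebra subfinite if it is (isomorphic to) a subalgebra of a finitely generated $R$-algebra; a subfinite algebra need not be finitely generated. If $B$ is a subfinite $R$-algebra and $A \subseteq B$ is an $R$-subalgebra (hence also subfinite), then $$\dim A \le \dim B.$$ Consequently, if $A$ is a finitely generated $\mathbb{Z}$-algebra, $\operatorname{Aut}(A)$ is its group of ($\mathbb{Z}$-algebra, equivalently ring) automorphisms, and $H \subseteq G \subseteq \operatorname{Aut}(A)$ are subgroups, then the rings of invariants $A^G=\{a\in A : \sigma(a)=a \text{ for all } \sigma\in G\}$ and $A^H$ satisfy $$\dim(A^G) \le \dim(A^H).$$ -/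

import Mathlib

universe u v w x

/-- A (commutative) `R`-algebra `A` is *subfinite* if it is (isomorphic, as an `R`-algebra, to)
a subalgebra of a finitely generated commutative `R`-algebra `C`, i.e. if it embeds into such a
`C`. Every finitely generated `R`-algebra is isomorphic to one in the universe of `R` (a quotient
of a polynomial ring), so placing `C` there loses nothing; see `IsSubfinite.of_injective`. -/
def IsSubfinite (R : Type u) (A : Type v) [CommRing R] [CommRing A] [Algebra R A] : Prop :=
  ∃ (C : Type u) (_ : CommRing C) (_ : Algebra R C), Algebra.FiniteType R C ∧
    ∃ f : A →ₐ[R] C, Function.Injective f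

/-- An algebra that embeds into a finitely generated algebra, in any universe, is subfinite. -/
theorem IsSubfinite.of_injective {R : Type u} {A : Type v} {C : Type w} [CommRing R] [CommRing A]
    [Algebra R A] [CommRing C] [Algebra R C] (hC : Algebra.FiniteType R C)
    (f : A →ₐ[R] C) (hf : Function.Injective f) : IsSubfinite R A := by
  obtain ⟨n, g, hg⟩ := Algebra.FiniteType.iff_quotient_mvPolynomial''.1 hC
  let e : (MvPolynomial (Fin n) R ⧸ RingHom.ker g) ≃ₐ[R] C :=
    Ideal.quotientKerAlgEquivOfSurjective hg
  refine ⟨MvPolynomial (Fin n) R ⧸ RingHom.ker g, inferInstance, inferInstance,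
    Algebra.FiniteType.equiv hC e.symm, (e.symm : C →ₐ[R] _).comp f, ?_⟩
  rw [AlgHom.coe_comp]
  exact e.symm.injective.comp hf

/-! A chain of primes in `A` involves finitely many strict inclusions, so it stays strict on a
finitely generated subalgebra `D`, again Noetherian and Jacobson. If some chain of `D` of the same
length lifts to the finite type extension `C`, the lift contracts to a chain in `B`, strict because
it is strict over `D`.

Lifting is generic: a finite type extension of domains is a polynomial extension followed by one
that becomes integral after inverting an element, so chains avoiding a suitable `s ≠ 0` lift
(`exists_ne_zero_lift_of_finiteType`). The given chain may meet `s`, but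
`exists_ltSeries_notMem_last` trades it for one that does not: Krull's theorem and prime avoidance
move the intermediate primes, and the Jacobson property supplies the top one. -/

open PrimeSpectrum

/-! ### Chains avoiding an element -/

/-- In a Noetherian ring, an intermediate prime in `p < q < r` can be replaced by one that avoids
a given element outside `p`. -/
theorem exists_prime_between_notMem {R : Type*} [CommRing R] [IsNoetherianRing R]
    {p q r : PrimeSpectrum R} (hpq : p < q) (hqr : q < r) {s : R} (hs : s ∉ p.asIdeal) :
    ∃ q' : PrimeSpectrum R, p < q' ∧ q' < r ∧ s ∉ q'.asIdeal := by
  by_cases hsq : s ∈ q.asIdeal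
  swap
  · exact ⟨q, hpq, hqr, hsq⟩
  have hJq : p.asIdeal ⊔ Ideal.span {s} ≤ q.asIdeal :=
    sup_le hpq.le ((Ideal.span_singleton_le_iff_mem _).mpr hsq)
  -- Prime avoidance: a minimal prime over `p + (s)` containing `r` would contain `q`, hence equal
  -- `q` by minimality. The new prime will be minimal over `p + (x)`.
  obtain ⟨x, hxr, hx⟩ : ∃ x ∈ r.asIdeal,
      ∀ m ∈ (p.asIdeal ⊔ Ideal.span {s}).minimalPrimes, x ∉ m := by
    have h : ¬ ((r.asIdeal : Set R) ⊆
        ⋃ m ∈ (p.asIdeal ⊔ Ideal.span {s}).minimalPrimes, (m : Set R)) := by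
      rw [Ideal.subset_union_prime_finite (f := fun m : Ideal R => m)
        (Ideal.finite_minimalPrimes_of_isNoetherianRing R _) ⊥ ⊥ fun m hm _ _ => hm.1.1]
      rintro ⟨m, hm, hrm⟩
      have h1 : m ≤ q.asIdeal := hm.2 ⟨q.2, hJq⟩ (le_trans (b := r.asIdeal) hqr.le hrm)
      exact hqr.not_ge (hrm.trans h1)
    obtain ⟨x, hxr, hx⟩ := Set.not_subset.mp h
    exact ⟨x, hxr, fun m hm hxm => hx (Set.mem_biUnion hm hxm)⟩
  obtain ⟨m₀, hm₀, -⟩ := Ideal.exists_minimalPrimes_le hJq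
  have hxp : x ∉ p.asIdeal := fun h => hx m₀ hm₀ (hm₀.1.2 (le_sup_left (α := Ideal R) h))
  obtain ⟨n, hn, hnr⟩ := Ideal.exists_minimalPrimes_le
    (show p.asIdeal ⊔ Ideal.span {x} ≤ r.asIdeal from
      sup_le (hpq.trans hqr).le ((Ideal.span_singleton_le_iff_mem _).mpr hxr))
  have hxn : x ∈ n := hn.1.2 (le_sup_right (α := Ideal R) (Ideal.mem_span_singleton_self x))
  -- by Krull's theorem there is no prime strictly between `p` and `n`
  have key : ∀ t : PrimeSpectrum R, p < t → ¬ t < ⟨n, hn.1.1⟩ := by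
    intro t hpt htn
    obtain ⟨u, hxu, hpu, hun⟩ := exist_mem_one_of_mem_two hpt htn hxn
    exact hun.not_ge (hn.2 ⟨u.2, sup_le hpu.le
      ((Ideal.span_singleton_le_iff_mem _).mpr hxu)⟩ hun.le)
  refine ⟨⟨n, hn.1.1⟩, ?_, ?_, ?_⟩
  · exact lt_of_le_not_ge (le_sup_left.trans hn.1.2) fun h => hxp (h hxn)
  · refine lt_of_le_not_ge hnr fun h => key q hpq (hqr.trans_le h)
  · intro hsn
    have := hn.1.1
    obtain ⟨m, hm, hmn⟩ := Ideal.exists_minimalPrimes_le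
      (show p.asIdeal ⊔ Ideal.span {s} ≤ n from
        sup_le (le_sup_left.trans hn.1.2) ((Ideal.span_singleton_le_iff_mem _).mpr hsn))
    have hsm : s ∈ m := hm.1.2 (le_sup_right (α := Ideal R) (Ideal.mem_span_singleton_self s))
    exact key ⟨m, hm.1.1⟩ (lt_of_le_not_ge (le_sup_left.trans hm.1.2) fun h => hs (h hsm))
      (lt_of_le_not_ge hmn fun h => hx m hm (h hxn))

/-- In a Noetherian Jacobson ring, a chain of primes strictly above `p` can be replaced by one of
the same length whose members avoid a given element outside `p`. -/
theorem exists_ltSeries_notMem_last {R : Type*} [CommRing R] [IsNoetherianRing R]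
    [IsJacobsonRing R] {s : R} (l : LTSeries (PrimeSpectrum R)) :
    ∀ p : PrimeSpectrum R, s ∉ p.asIdeal → p < l.head →
      ∃ l' : LTSeries (PrimeSpectrum R), l'.length = l.length ∧ p < l'.head ∧
        s ∉ l'.last.asIdeal := by
  induction l using RelSeries.inductionOn with
  | singleton q =>
    intro p hs hpq
    have hj : p.asIdeal.jacobson = p.asIdeal := IsJacobsonRing.out ‹_› p.2.isRadical
    -- The top prime becomes a maximal ideal; it differs from `p` because `p < q` is not maximal.
    obtain ⟨m, ⟨hpm, hm⟩, hsm⟩ : ∃ m ∈ {J : Ideal R | p.asIdeal ≤ J ∧ J.IsMaximal}, s ∉ m := by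
      by_contra! h
      exact hs (hj ▸ Ideal.mem_sInf.mpr fun {m} hm => h m hm)
    refine ⟨RelSeries.singleton _ ⟨m, hm.isPrime⟩, rfl, ?_, hsm⟩
    refine lt_of_le_not_ge hpm fun hmp => ?_
    have : m < q.asIdeal := lt_of_le_of_lt hmp hpq
    exact q.2.ne_top (hm.1.2 _ this)
  | cons l q hq ih =>
    intro p hs hpq
    -- The replacement `q'` serves as the lower bound for the rest of the chain.
    obtain ⟨q', hpq', hq', hsq'⟩ := exists_prime_between_notMem hpq hq hs
    obtain ⟨l', hl', hh, hsl⟩ := ih q' hsq' hq'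
    exact ⟨l'.cons q' hh, by simp [hl'], by simpa using hpq', by simpa using hsl⟩

/-! ### Lifting chains of primes -/

/-- Increasing sequences of primes lift along an injective integral extension. -/
theorem exists_monotone_comap_eq_of_isIntegral {R S : Type*} [CommRing R] [CommRing S]
    [Algebra R S] [Algebra.IsIntegral R S] (hinj : Function.Injective (algebraMap R S))
    (M : ℕ → PrimeSpectrum R) (hM : Monotone M) :
    ∃ N : ℕ → PrimeSpectrum S, Monotone N ∧
      ∀ i, (N i).comap (algebraMap R S) = M i := by
  have h0 : ∃ P : PrimeSpectrum S, P.comap (algebraMap R S) = M 0 := by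
    obtain ⟨Q, -, hQ, hQM⟩ := Ideal.exists_ideal_over_prime_of_isIntegral (M 0).asIdeal (⊥ : Ideal S)
      (by rw [← RingHom.ker_eq_comap_bot, (RingHom.injective_iff_ker_eq_bot _).mp hinj]
          exact bot_le)
    exact ⟨⟨Q, hQ⟩, PrimeSpectrum.ext hQM⟩
  have h1 : ∀ (i : ℕ) (P : PrimeSpectrum S), P.comap (algebraMap R S) = M i →
      ∃ Q, P ≤ Q ∧ Q.comap (algebraMap R S) = M (i + 1) := by
    intro i P hP
    obtain ⟨Q, hPQ, hQ, hQM⟩ := Ideal.exists_ideal_over_prime_of_isIntegral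
      (M (i + 1)).asIdeal P.asIdeal (by
        have := hM (Nat.le_succ i)
        rw [← hP] at this
        exact this)
    exact ⟨⟨Q, hQ⟩, hPQ, PrimeSpectrum.ext hQM⟩
  obtain ⟨P₀, hP₀⟩ := h0
  choose! next hle hnext using h1
  let N : ℕ → PrimeSpectrum S := fun i => Nat.rec P₀ next i
  have hN : ∀ i, (N i).comap (algebraMap R S) = M i := by
    intro i
    induction i with
    | zero => exact hP₀
    | succ i ih => exact hnext i _ ih
  exact ⟨N, monotone_nat_of_le_succ fun i => hle i _ (hN i), hN⟩

/-- For an algebraic finite type extension of domains, there is a nonzero element of the base such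
that increasing sequences of primes avoiding it lift. -/
theorem exists_ne_zero_lift_of_isAlgebraic {R S : Type*} [CommRing R] [IsDomain R] [CommRing S]
    [IsDomain S] [Algebra R S] [Algebra.IsAlgebraic R S] [Algebra.FiniteType R S]
    (hinj : Function.Injective (algebraMap R S)) :
    ∃ s : R, s ≠ 0 ∧ ∀ M : ℕ → PrimeSpectrum R, Monotone M → (∀ i, s ∉ (M i).asIdeal) →
      ∃ N : ℕ → PrimeSpectrum S, Monotone N ∧ ∀ i, (N i).comap (algebraMap R S) = M i := by
  obtain ⟨G, hG⟩ := Algebra.FiniteType.out (R := R) (A := S)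
  -- `s` clears the denominators of all generators at once, so `S` becomes integral over `R` once
  -- `s` is inverted.
  obtain ⟨s, hs, hint⟩ := Algebra.IsAlgebraic.exists_integral_multiples R G
  refine ⟨s, hs, fun M hM hsM => ?_⟩
  let W := Submonoid.powers s
  let Rs := Localization W
  let Ss := Localization (Algebra.algebraMapSubmonoid S W)
  let : Algebra Rs Ss := localizationAlgebra W S
  have : IsScalarTower R Rs Ss := IsScalarTower.of_algebraMap_eq' (by
    rw [localizationAlgebraMap_def, IsLocalization.map_comp, ← IsScalarTower.algebraMap_eq])
  have hW : W ≤ nonZeroDivisors R := powers_le_nonZeroDivisors_of_noZeroDivisors hs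
  have h0S : (0 : S) ∉ Algebra.algebraMapSubmonoid S W := by
    rintro ⟨w, hw, h0⟩
    rw [map_eq_zero_iff _ hinj] at h0
    exact nonZeroDivisors.ne_zero (hW hw) h0
  have hinj' : Function.Injective (algebraMap Rs Ss) := by
    rw [localizationAlgebraMap_def]
    exact IsLocalization.map_injective_of_injective' (M := W) (Rₘ := Rs)
      (N := Algebra.algebraMapSubmonoid S W) _ Ss W.le_comap_map h0S hinj
  have hS : ∀ c : S, IsIntegral Rs (algebraMap S Ss c) := by
    let T : Subalgebra R S := ((integralClosure Rs Ss).restrictScalars R).comap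
      (IsScalarTower.toAlgHom R S Ss)
    have hT : T = ⊤ := by
      rw [eq_top_iff, ← hG, Algebra.adjoin_le_iff]
      intro z hz
      change IsIntegral Rs (algebraMap S Ss z)
      have h1 : IsIntegral Rs (algebraMap S Ss (s • z)) :=
        ((hint z hz).map (IsScalarTower.toAlgHom R S Ss)).tower_top
      have h2 : algebraMap S Ss z =
          (IsLocalization.mk' Rs 1 (⟨s, Submonoid.mem_powers s⟩ : W)) •
            algebraMap S Ss (s • z) := by
        rw [Algebra.smul_def s z, map_mul, ← IsScalarTower.algebraMap_apply R S Ss,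
          IsScalarTower.algebraMap_apply R Rs Ss, ← Algebra.smul_def, smul_smul,
          IsLocalization.mk'_spec_mk, map_one, one_smul]
      rw [h2]
      exact h1.smul _
    intro c
    have : c ∈ T := hT ▸ Algebra.mem_top
    exact this
  have : Algebra.IsIntegral Rs Ss := ⟨fun x => by
    obtain ⟨c, ⟨_, w, hw, rfl⟩, rfl⟩ := IsLocalization.exists_mk'_eq (Algebra.algebraMapSubmonoid S W) x
    have h2 : IsLocalization.mk' Ss c (⟨algebraMap R S w, w, hw, rfl⟩ :
        Algebra.algebraMapSubmonoid S W) =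
          (IsLocalization.mk' Rs 1 (⟨w, hw⟩ : W)) • algebraMap S Ss c := by
      rw [IsLocalization.mk'_eq_iff_eq_mul, Algebra.smul_def, mul_assoc, mul_comm, mul_assoc,
        ← IsScalarTower.algebraMap_apply R S Ss, IsScalarTower.algebraMap_apply R Rs Ss, ← map_mul,
        mul_comm (algebraMap R Rs w), IsLocalization.mk'_spec, map_one, map_one, mul_one]
    rw [h2]
    exact (hS c).smul _⟩
  have hdisj : ∀ i, Disjoint (W : Set R) (M i).asIdeal := fun i => by
    rw [Set.disjoint_left]
    rintro _ ⟨k, rfl⟩ hk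
    exact hsM i ((M i).2.mem_of_pow_mem k hk)
  let M' : ℕ → PrimeSpectrum Rs := fun i => ⟨(M i).asIdeal.map (algebraMap R Rs),
    IsLocalization.isPrime_of_isPrime_disjoint W Rs _ (M i).2 (hdisj i)⟩
  obtain ⟨N, hN, hNM⟩ := exists_monotone_comap_eq_of_isIntegral hinj' M'
    fun i j hij => Ideal.map_mono (hM hij)
  refine ⟨fun i => (N i).comap (algebraMap S Ss), fun i j hij => Ideal.comap_mono (hN hij),
    fun i => ?_⟩
  have h3 : (M' i).comap (algebraMap R Rs) = M i := PrimeSpectrum.ext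
    (IsLocalization.under_map_of_isPrime_disjoint W Rs (M i).2 (hdisj i))
  rw [← h3, ← hNM, ← PrimeSpectrum.comap_comp_apply, ← PrimeSpectrum.comap_comp_apply,
    ← IsScalarTower.algebraMap_eq, ← IsScalarTower.algebraMap_eq]

/-- For a finite type extension of domains, there is a nonzero element of the base such
that increasing sequences of primes avoiding it lift. -/
theorem exists_ne_zero_lift_of_finiteType {R S : Type*} [CommRing R] [IsDomain R] [CommRing S]
    [IsDomain S] [Algebra R S] [Algebra.FiniteType R S] [FaithfulSMul R S] :
    ∃ s : R, s ≠ 0 ∧ ∀ M : ℕ → PrimeSpectrum R, Monotone M → (∀ i, s ∉ (M i).asIdeal) →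
      ∃ N : ℕ → PrimeSpectrum S, Monotone N ∧ ∀ i, (N i).comap (algebraMap R S) = M i := by
  obtain ⟨ι, x, hx⟩ := exists_isTranscendenceBasis' R S
  let E := MvPolynomial ι R
  let : Algebra E S := (MvPolynomial.aeval x : E →ₐ[R] S).toAlgebra
  have hE : Function.Injective (algebraMap E S) := hx.1
  have : IsScalarTower R E S := IsScalarTower.of_algebraMap_eq' (MvPolynomial.aeval x :
    E →ₐ[R] S).comp_algebraMap.symm
  have : Algebra.FiniteType E S := Algebra.FiniteType.of_restrictScalars_finiteType R E S
  have : Algebra.IsAlgebraic E S := by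
    have := hx.isAlgebraic
    rw [Algebra.adjoin_range_eq_range_aeval] at this
    exact ⟨fun c => by
      refine (this.isAlgebraic c).of_ringHom_of_comp_eq (MvPolynomial.aeval x : E →ₐ[R] S).rangeRestrict
        (RingHom.id S) (AlgHom.rangeRestrict_surjective _) Function.injective_id ?_
      rfl⟩
  obtain ⟨f, hf, hlift⟩ := exists_ne_zero_lift_of_isAlgebraic hE
  obtain ⟨m, hm⟩ := MvPolynomial.ne_zero_iff.mp hf
  -- An extended prime contains `f` only if the prime contains every coefficient of `f`, so avoiding
  -- one nonzero coefficient suffices.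
  refine ⟨f.coeff m, hm, fun M hM hMs => ?_⟩
  have hprime : ∀ i, ((M i).asIdeal.map (MvPolynomial.C : R →+* E)).IsPrime := fun i => by
    have h := MvPolynomial.ker_map (σ := ι) (Ideal.Quotient.mk (M i).asIdeal)
    rw [Ideal.mk_ker] at h
    rw [← h]
    exact RingHom.ker_isPrime _
  obtain ⟨N, hN, hNM⟩ := hlift (fun i => ⟨_, hprime i⟩) (fun i j hij => Ideal.map_mono (hM hij))
    fun i h => hMs i (MvPolynomial.mem_map_C_iff.mp h m)
  refine ⟨N, hN, fun i => ?_⟩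
  rw [IsScalarTower.algebraMap_eq R E S, PrimeSpectrum.comap_comp_apply, hNM]
  ext a
  change MvPolynomial.C a ∈ (M i).asIdeal.map (MvPolynomial.C : R →+* E) ↔ _
  refine ⟨fun h => ?_, fun h => Ideal.mem_map_of_mem _ h⟩
  simpa using MvPolynomial.mem_map_C_iff.mp h 0

/-! ### Comparison of dimensions -/

/-- A chain of primes in a Noetherian Jacobson ring `R` yields an increasing sequence of primes of
an extension of finite type whose contractions to `R` form a chain of the same length. -/
theorem exists_monotone_strictMonoOn_comap {R S : Type*} [CommRing R] [IsNoetherianRing R]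
    [IsJacobsonRing R] [CommRing S] [Algebra R S] [Algebra.FiniteType R S]
    (hinj : Function.Injective (algebraMap R S)) (l : LTSeries (PrimeSpectrum R)) :
    ∃ N : ℕ → PrimeSpectrum S, Monotone N ∧
      StrictMonoOn (fun i => (N i).comap (algebraMap R S)) (Set.Iic l.length) := by
  -- Injectivity alone guarantees a prime of `S` over each minimal prime, so the chain is restarted
  -- at a minimal one.
  obtain ⟨p, hp, hpl⟩ := Ideal.exists_minimalPrimes_le (bot_le : ⊥ ≤ l.head.asIdeal)
  obtain ⟨q, hq, hqp⟩ := Ideal.exists_comap_eq_of_mem_minimalPrimes_of_injective hinj p hp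
  have : p.IsPrime := hp.1.1
  have : q.LiesOver p := ⟨hqp.symm⟩
  have : Algebra.FiniteType R (S ⧸ q) :=
    .of_surjective (IsScalarTower.toAlgHom R S (S ⧸ q)) Ideal.Quotient.mk_surjective
  have : Algebra.FiniteType (R ⧸ p) (S ⧸ q) := .of_restrictScalars_finiteType R _ _
  obtain ⟨s, hs, hlift⟩ := exists_ne_zero_lift_of_finiteType (R := R ⧸ p) (S := S ⧸ q)
  obtain ⟨s, rfl⟩ := Ideal.Quotient.mk_surjective s
  rw [Ne, Ideal.Quotient.eq_zero_iff_mem] at hs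
  obtain ⟨l', hlen, hhead, hlast⟩ : ∃ l' : LTSeries (PrimeSpectrum R), l'.length = l.length ∧
      l'.head = ⟨p, hp.1.1⟩ ∧ s ∉ l'.last.asIdeal := by
    clear hlift
    induction l using RelSeries.inductionOn with
    | singleton r => exact ⟨RelSeries.singleton _ ⟨p, hp.1.1⟩, rfl, rfl, hs⟩
    | cons l r hr _ =>
      obtain ⟨l', h1, h2, h3⟩ := exists_ltSeries_notMem_last l ⟨p, hp.1.1⟩ hs
        (lt_of_le_of_lt (b := r) (by simpa using! hpl) hr)
      exact ⟨l'.cons _ h2, by simp [h1], by simp, by simpa using h3⟩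
  -- The chain is continued by its last term to give an infinite sequence.
  let M : ℕ → PrimeSpectrum R := fun i => l' (Fin.ofNat _ (min i l'.length))
  have hMstrict : StrictMonoOn M (Set.Iic l.length) := by
    intro i hi j hj hij
    apply l'.strictMono
    simp only [Set.mem_Iic] at hi hj
    rw [Fin.lt_def]
    simp only [Fin.val_ofNat]
    rw [Nat.mod_eq_of_lt (by omega), Nat.mod_eq_of_lt (by omega)]
    omega
  have hM : Monotone M := by
    intro i j hij
    apply l'.monotone
    rw [Fin.le_def]
    simp only [Fin.val_ofNat]
    rw [Nat.mod_eq_of_lt (by omega), Nat.mod_eq_of_lt (by omega)]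
    omega
  have hpM : ∀ i, p ≤ (M i).asIdeal := fun i => by
    have h := l'.head_le (Fin.ofNat _ (min i l'.length))
    rw [hhead] at h
    exact h
  have hsM : ∀ i, s ∉ (M i).asIdeal := fun i h => hlast (l'.monotone (Fin.le_last _) h)
  have hprime : ∀ i, ((M i).asIdeal.map (Ideal.Quotient.mk p)).IsPrime := fun i =>
    Ideal.map_isPrime_of_surjective Ideal.Quotient.mk_surjective (by simpa using hpM i)
  have hcomap : ∀ i, ((M i).asIdeal.map (Ideal.Quotient.mk p)).comap (Ideal.Quotient.mk p) =
      (M i).asIdeal := fun i => by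
    rw [Ideal.comap_map_of_surjective _ Ideal.Quotient.mk_surjective, ← RingHom.ker_eq_comap_bot,
      Ideal.mk_ker, sup_eq_left.mpr (hpM i)]
  obtain ⟨N, hN, hNM⟩ := hlift (fun i => ⟨_, hprime i⟩) (fun i j hij => Ideal.map_mono (hM hij))
    fun i h => hsM i (by rw [← hcomap]; exact h)
  refine ⟨fun i => (N i).comap (algebraMap S (S ⧸ q)), fun i j hij => Ideal.comap_mono (hN hij),
    ?_⟩
  convert hMstrict using 2 with i
  rw [← PrimeSpectrum.comap_comp_apply, ← IsScalarTower.algebraMap_eq,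
    IsScalarTower.algebraMap_eq R (R ⧸ p), PrimeSpectrum.comap_comp_apply, hNM]
  exact PrimeSpectrum.ext (hcomap i)

/-- Over a Noetherian Jacobson ring, the Krull dimension is monotone among subalgebras of an algebra
of finite type. -/
theorem ringKrullDim_le_of_injective_of_finiteType {R A B C : Type*} [CommRing R]
    [IsNoetherianRing R] [IsJacobsonRing R] [CommRing A] [Algebra R A] [CommRing B] [Algebra R B]
    [CommRing C] [Algebra R C] [Algebra.FiniteType R C] (f : A →ₐ[R] B)
    (hf : Function.Injective f) (g : B →ₐ[R] C) (hg : Function.Injective g) :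
    ringKrullDim A ≤ ringKrullDim B := by
  refine iSup_le fun l => ?_
  have hex : ∀ i : Fin l.length, ∃ a ∈ (l i.succ).asIdeal, a ∉ (l i.castSucc).asIdeal := fun i =>
    Set.not_subset.mp (l.strictMono i.castSucc_lt_succ).not_ge
  choose a ha ha' using hex
  let D : Subalgebra R A := Algebra.adjoin R (Set.range a)
  have : Algebra.FiniteType R D :=
    (Subalgebra.fg_iff_finiteType _).mp (by
      have h := Subalgebra.fg_adjoin_finset (R := R) (Set.finite_range a).toFinset
      rwa [Set.Finite.coe_toFinset] at h)
  have : IsNoetherianRing D := Algebra.FiniteType.isNoetherianRing R D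
  have : IsJacobsonRing D := isJacobsonRing_of_finiteType (A := R)
  let φ : D →ₐ[R] B := f.comp D.val
  let ψ : D →ₐ[R] C := g.comp φ
  let : Algebra D C := ψ.toAlgebra
  have hψ : Function.Injective (algebraMap D C) := hg.comp (hf.comp Subtype.val_injective)
  have : IsScalarTower R D C := IsScalarTower.of_algebraMap_eq' ψ.comp_algebraMap.symm
  have : Algebra.FiniteType D C := .of_restrictScalars_finiteType R D C
  let l' : LTSeries (PrimeSpectrum D) :=
    { length := l.length
      toFun := fun i => (l i).comap (D.val : D →+* A)
      step := fun i => lt_of_le_not_ge (Ideal.comap_mono (l.strictMono i.castSucc_lt_succ).le)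
        fun h => ha' i (h (show (⟨a i, Algebra.subset_adjoin ⟨i, rfl⟩⟩ : D) ∈
          Ideal.comap (D.val : D →+* A) (l i.succ).asIdeal from ha i)) }
  obtain ⟨N, hN, hNs⟩ := exists_monotone_strictMonoOn_comap hψ l'
  let L : LTSeries (PrimeSpectrum B) :=
    { length := l.length
      toFun := fun i => (N i).comap (g : B →+* C)
      step := fun i => lt_of_le_not_ge (Ideal.comap_mono (hN (by simp)))
        fun h => (hNs (a := i) (b := i + 1) (by simp [l', i.2.le]) (by simp [l'])
          (Nat.lt_succ_self _)).not_ge (Ideal.comap_mono (f := (φ : D →+* B)) h) }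
  exact Order.LTSeries.length_le_krullDim L

instance Int.isJacobsonRing : IsJacobsonRing ℤ := by
  refine isJacobsonRing_iff_prime_eq.mpr fun P hP => ?_
  by_cases h : P = ⊥
  · subst h
    refine le_antisymm (fun x hx => ?_) Ideal.le_jacobson
    -- `x * x + 1` is a unit of `ℤ`, hence `±1`, which forces `x = 0`.
    have hu := Ideal.mem_jacobson_bot.mp hx x
    rcases Int.isUnit_iff.mp hu with h1 | h1 <;> simp only [Ideal.mem_bot] <;> nlinarith
  · have := IsPrime.to_maximal_ideal h
    exact Ideal.jacobson_eq_self_of_isMaximal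

/-- Dimensions are Krull dimensions with values in `WithBot ℕ∞`. An inclusion of `R`-algebras is
given as an injective `R`-algebra homomorphism. -/
theorem corollary4p7 :
    (∀ (R : Type u) [CommRing R] [IsNoetherianRing R] [IsJacobsonRing R]
      (A : Type v) [CommRing A] [Algebra R A] (B : Type w) [CommRing B] [Algebra R B]
      (_hA : IsSubfinite R A) (_hB : IsSubfinite R B)
      (f : A →ₐ[R] B) (_hf : Function.Injective f),
      ringKrullDim A ≤ ringKrullDim B) ∧
    (∀ (A : Type x) [CommRing A] [Algebra.FiniteType ℤ A]
      (H G : Subgroup (A ≃ₐ[ℤ] A)) (_hHG : H ≤ G),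
      ringKrullDim (FixedPoints.subalgebra ℤ A G) ≤
        ringKrullDim (FixedPoints.subalgebra ℤ A H)) := by
  refine ⟨?_, ?_⟩
  · intro R _ _ _ A _ _ B _ _ _ hB f hf
    obtain ⟨C, _, _, _, g, hg⟩ := hB
    exact ringKrullDim_le_of_injective_of_finiteType f hf g hg
  · intro A _ _ H G hHG
    have hle : FixedPoints.subalgebra ℤ A G ≤ FixedPoints.subalgebra ℤ A H :=
      fun a ha σ => ha ⟨σ, hHG σ.2⟩
    exact ringKrullDim_le_of_injective_of_finiteType (Subalgebra.inclusion hle)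
      (Subalgebra.inclusion_injective hle) (FixedPoints.subalgebra ℤ A H).val
      Subtype.val_injective
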